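/- Let $a,b,c,d$ be elements of a commutative ring $R$ (for example indeterminates over $\mathbb{Z}$ or $\mathbb{Q}$, with $R$ the polynomial ring they generate). For a partition $\lambda=(\lambda_1\ge\lambda_2\ge\cdots)$ put $$\omega(\lambda)=a^{\sum_{i\ge1}\lceil\lambda_{2i-1}/2\rceil}\,b^{\sum_{i\ge1}\lfloor\lambda_{2i-1}/2\rfloor}\,c^{\sum_{i\ge1}\lceil\lambda_{2i}/2\rceil}\,d^{\sum_{i\ge1}\lfloor\lambda_{2i}/2\rfloor},$$ and for an integer $n\ge0$ and variables $X_{2n}=(x_1,\dots,x_{2n})$ let $$z_n(X_{2n})=\sum_{\ell(\lambda)\le 2n}\omega(\lambda)\,s_\lambda(x_1,\dots,x_{2n})\in R[[x_1,\dots,x_{2n}]],$$ where the sum is over all partitions $\lambda$ with at most $2n$ nonzero parts and $s_\lambda(x_1,\dots,x_{2n})=\det\bigl(x_i^{\lambda_j+2n-j}\bigr)_{1\le i,j\le 2n}\big/\prod_{1\le i<j\le 2n}(x_i-x_j)$ is the Schur polynomial. Proposition. For every $n\ge0$, in the ring of formal power series $R[[t,x_1,\dots,x_{2n}]]$, $$z_{n+1}(t,-t,X_{2n})=\frac{1-act^2}{(1-abt^2)(1-abcdt^4)\prod_{i=1}^{2n}(1-abcd\,t^2x_i^2)}\;z_n(X_{2n}),$$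 where $z_{n+1}(t,-t,X_{2n})$ is the result of substituting $t,-t,x_1,\dots,x_{2n}$ for the $2n+2$ variables of $z_{n+1}$. -/

import Mathlib

namespace StanleySchur

open MvPolynomial

/-- The product `∏_{i<j} (x_i - x_j)` in `ℤ[x_1, …, x_N]`. -/
noncomputable def vandermonde (N : ℕ) : MvPolynomial (Fin N) ℤ :=
  ∏ p ∈ (Finset.univ : Finset (Fin N × Fin N)).filter (fun p => p.1 < p.2), (X p.1 - X p.2)

/-- The alternant `a_{λ+δ} = det (x_i ^ (λ_j + N - j))_{1 ≤ i, j ≤ N}` in `ℤ[x_1, …, x_N]`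
(the index `j : Fin N` is counted from `0`, so the exponent reads `λ_j + (N - 1 - j)`). -/
noncomputable def alternant {N : ℕ} (lam : Fin N → ℕ) : MvPolynomial (Fin N) ℤ :=
  Matrix.det (Matrix.of fun i j : Fin N => (X i : MvPolynomial (Fin N) ℤ) ^ (lam j + (N - 1 - j)))

theorem irreducible_X_sub_X {N : ℕ} {i j : Fin N} (h : i ≠ j) :
    Irreducible (X i - X j : MvPolynomial (Fin N) ℤ) := by
  classical
  have h1 : coeff (Finsupp.single i 1) (X i - X j : MvPolynomial (Fin N) ℤ) = 1 := by
    have : Finsupp.single j 1 ≠ (Finsupp.single i 1 : Fin N →₀ ℕ) := fun e =>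
      h ((Finsupp.single_left_injective one_ne_zero) e).symm
    simp [coeff_X, this]
  have hne : (X i - X j : MvPolynomial (Fin N) ℤ) ≠ 0 := by
    intro e
    rw [e] at h1
    simp at h1
  apply irreducible_of_totalDegree_eq_one
  · exact ((isHomogeneous_X ℤ i).sub (isHomogeneous_X ℤ j)).totalDegree hne
  · intro x hx
    exact isUnit_of_dvd_one (h1 ▸ hx (Finsupp.single i 1))

theorem vandermonde_ne_zero (N : ℕ) : vandermonde N ≠ 0 :=
  Finset.prod_ne_zero_iff.mpr fun _ hp =>
    (irreducible_X_sub_X (Finset.mem_filter.mp hp).2.ne).ne_zero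

theorem X_sub_X_dvd_alternant {N : ℕ} (lam : Fin N → ℕ) {i j : Fin N} (h : i ≠ j) :
    (X i - X j : MvPolynomial (Fin N) ℤ) ∣ alternant lam := by
  rw [← Ideal.mem_span_singleton, ← Ideal.Quotient.eq_zero_iff_mem, alternant, RingHom.map_det]
  have hx : Ideal.Quotient.mk (Ideal.span {(X i - X j : MvPolynomial (Fin N) ℤ)}) (X i) =
      Ideal.Quotient.mk _ (X j) :=
    Ideal.Quotient.eq.mpr (Ideal.mem_span_singleton_self _)
  refine Matrix.det_zero_of_row_eq h ?_
  funext k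
  simp [hx]

theorem vandermonde_dvd_alternant {N : ℕ} (lam : Fin N → ℕ) :
    vandermonde N ∣ alternant lam := by
  classical
  refine Finset.prod_dvd_of_isRelPrime ?_ fun p hp =>
    X_sub_X_dvd_alternant lam (Finset.mem_filter.mp hp).2.ne
  rintro ⟨i, j⟩ hp ⟨k, l⟩ hq hne
  have hij : i < j := by simpa using hp
  have hkl : k < l := by simpa using hq
  refine (irreducible_X_sub_X hij.ne).isRelPrime_iff_not_dvd.mpr ?_
  rintro ⟨r, hr⟩
  have e := congrArg
    (aeval fun s : Fin N => (X (if s = j then i else s) : MvPolynomial (Fin N) ℤ)) hr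
  simp only [map_sub, map_mul, aeval_X, if_true, hij.ne, if_false, sub_self, zero_mul,
    sub_eq_zero] at e
  have e' := X_injective e
  apply hne
  split_ifs at e' with h1 h2 h2 <;> grind

/-- The Schur polynomial `s_λ(x_1, …, x_N)` with integer coefficients, for a partition
`λ = (λ_1 ≥ ⋯ ≥ λ_N ≥ 0)`: the quotient of `a_{λ+δ}` by `∏_{i<j} (x_i - x_j)`. -/
noncomputable def schurPoly {N : ℕ} (lam : Fin N → ℕ) : MvPolynomial (Fin N) ℤ :=
  (vandermonde_dvd_alternant lam).choose

theorem vandermonde_mul_schurPoly {N : ℕ} (lam : Fin N → ℕ) :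
    vandermonde N * schurPoly lam = alternant lam :=
  (vandermonde_dvd_alternant lam).choose_spec.symm

/-- Partitions `λ` of length at most `N`, written as `λ_1 ≥ λ_2 ≥ ⋯ ≥ λ_N ≥ 0`. -/
def PartitionLE (N : ℕ) : Type := {lam : Fin N → ℕ // Antitone lam}

section

variable {R : Type*} [CommRing R]

/-- Stanley's weight
`ω(λ) = a^{∑ ⌈λ_{2i-1}/2⌉} b^{∑ ⌊λ_{2i-1}/2⌋} c^{∑ ⌈λ_{2i}/2⌉} d^{∑ ⌊λ_{2i}/2⌋}`.
The part `λ_{k+1}` is `lam k`, so the odd-numbered parts are those with even `k`. -/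
def omegaWeight (a b c d : R) {N : ℕ} (lam : Fin N → ℕ) : R :=
  a ^ (∑ k ∈ (Finset.univ : Finset (Fin N)).filter (fun k => Even k.val), (lam k + 1) / 2) *
  b ^ (∑ k ∈ (Finset.univ : Finset (Fin N)).filter (fun k => Even k.val), lam k / 2) *
  c ^ (∑ k ∈ (Finset.univ : Finset (Fin N)).filter (fun k => Odd k.val), (lam k + 1) / 2) *
  d ^ (∑ k ∈ (Finset.univ : Finset (Fin N)).filter (fun k => Odd k.val), lam k / 2)

/-- The formal power series `z_n(X_{2n}) = ∑_{ℓ(λ) ≤ 2n} ω(λ) s_λ(x_1, …, x_{2n})`,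
summed coefficient by coefficient (each coefficient is a finite sum, see
`finite_support_coeff_z`). -/
noncomputable def z (a b c d : R) (n : ℕ) : MvPowerSeries (Fin (2 * n)) R :=
  fun m => ∑ᶠ lam : PartitionLE (2 * n),
    omegaWeight a b c d lam.1 * Int.cast ((schurPoly lam.1).coeff m)

end

theorem alternant_isHomogeneous {N : ℕ} (lam : Fin N → ℕ) :
    (alternant lam).IsHomogeneous (∑ j, (lam j + (N - 1 - (j : ℕ)))) := by
  rw [alternant, Matrix.det_apply]
  refine IsHomogeneous.sum _ _ _ fun s _ => ?_
  have h : (∏ i, (Matrix.of fun i j : Fin N =>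
      (X i : MvPolynomial (Fin N) ℤ) ^ (lam j + (N - 1 - j))) (s i) i).IsHomogeneous
      (∑ j, (lam j + (N - 1 - (j : ℕ)))) :=
    IsHomogeneous.prod _ _ _ fun i _ => isHomogeneous_X_pow _ _
  rcases Int.units_eq_one_or (Equiv.Perm.sign s) with e | e
  · simpa [e] using h
  · simpa [e] using h.neg

theorem vandermonde_isHomogeneous (N : ℕ) :
    (vandermonde N).IsHomogeneous (∑ j : Fin N, (N - 1 - (j : ℕ))) := by
  have h : (vandermonde N).IsHomogeneous
      (∑ _p ∈ (Finset.univ : Finset (Fin N × Fin N)).filter (fun p => p.1 < p.2), 1) :=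
    IsHomogeneous.prod _ _ _ fun p _ => (isHomogeneous_X ℤ p.1).sub (isHomogeneous_X ℤ p.2)
  have e : ∑ _p ∈ (Finset.univ : Finset (Fin N × Fin N)).filter (fun p => p.1 < p.2), 1 =
      ∑ j : Fin N, (N - 1 - (j : ℕ)) := by
    rw [Finset.sum_filter, ← Finset.univ_product_univ, Finset.sum_product]
    refine Finset.sum_congr rfl fun i _ => ?_
    rw [← Finset.sum_filter, Finset.sum_const, smul_eq_mul, mul_one, ← Fin.card_Ioi]
    congr 1
    ext j
    simp
  rwa [e] at h

/-- `s_λ` is homogeneous of degree `|λ|`. -/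
theorem coeff_schurPoly_eq_zero {N : ℕ} (lam : Fin N → ℕ) (m : Fin N →₀ ℕ)
    (h : m.degree ≠ ∑ j, lam j) : (schurPoly lam).coeff m = 0 := by
  let _ := MvPolynomial.gradedAlgebra (σ := Fin N) (R := ℤ)
  set D := ∑ j : Fin N, (N - 1 - (j : ℕ)) with hD
  have hV : vandermonde N ∈ homogeneousSubmodule (Fin N) ℤ D := vandermonde_isHomogeneous N
  have hA : alternant lam ∈ homogeneousSubmodule (Fin N) ℤ (∑ j, lam j + D) := by
    have := alternant_isHomogeneous lam
    rwa [Finset.sum_add_distrib] at this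
  have h1 := DirectSum.coe_decompose_mul_add_of_left_mem
    (homogeneousSubmodule (Fin N) ℤ) (j := m.degree) (b := schurPoly lam) hV
  rw [vandermonde_mul_schurPoly,
    DirectSum.decompose_of_mem_ne (homogeneousSubmodule (Fin N) ℤ) hA (by omega)] at h1
  have h2 := (mul_eq_zero.mp h1.symm).resolve_left (vandermonde_ne_zero N)
  have h3 : homogeneousComponent m.degree (schurPoly lam) = 0 :=
    (decomposition.decompose'_apply (schurPoly lam) m.degree).symm.trans h2
  have h4 := coeff_homogeneousComponent m.degree (schurPoly lam) m
  rw [h3] at h4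
  simpa using h4.symm

theorem finite_support_coeff_z {R : Type*} [CommRing R] (a b c d : R) (n : ℕ)
    (m : Fin (2 * n) →₀ ℕ) :
    (Function.support fun lam : PartitionLE (2 * n) =>
      omegaWeight a b c d lam.1 * Int.cast ((schurPoly lam.1).coeff m)).Finite := by
  have hfin : {f : Fin (2 * n) → ℕ | ∀ i, f i ≤ m.degree}.Finite := by
    have := Set.finite_Iic (fun _ : Fin (2 * n) => m.degree)
    exact this.subset fun f hf => hf
  refine (hfin.preimage (f := Subtype.val) Subtype.val_injective.injOn).subset ?_
  intro lam hlam i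
  by_contra hlt
  refine hlam ?_
  have : m.degree ≠ ∑ j, lam.1 j := by
    have := Finset.single_le_sum (f := lam.1) (fun _ _ => Nat.zero_le _) (Finset.mem_univ i)
    omega
  simp [coeff_schurPoly_eq_zero lam.1 m this]

/-- The arguments `(t, -t, x_1, …, x_{2n})`, where `t` is the variable `none` and `x_i` is the
variable `some i` of the power series ring `R⟦t, x_1, …, x_{2n}⟧`. -/
noncomputable def pmArgs (R : Type*) [CommRing R] (n : ℕ) :
    Fin (2 * (n + 1)) → MvPowerSeries (Option (Fin (2 * n))) R :=
  Fin.cons (MvPowerSeries.X none) (Fin.cons (-MvPowerSeries.X none)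
    fun i : Fin (2 * n) => MvPowerSeries.X (some i))

/-- Substituting `(t, -t, x_1, …, x_{2n})` into a power series is legitimate. -/
theorem hasSubst_pmArgs (R : Type*) [CommRing R] (n : ℕ) :
    MvPowerSeries.HasSubst (pmArgs R n) := by
  refine MvPowerSeries.hasSubst_of_constantCoeff_zero fun s => ?_
  change Fin (2 * n + 1 + 1) at s
  refine Fin.cases ?_ (fun s => Fin.cases ?_ (fun s => ?_) s) s <;> simp [pmArgs]

end StanleySchur

namespace StanleySchur

/-! ### Strictly decreasing sequences, the exponents λ + δ -/

open Finset

/-! Put q = abcd. Up to a constant factor depending on n only, ω(λ) is a product over the entries of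
λ + δ, with weights f and g alternating. Hence the Vandermonde product V times z_n is a weighted sum
of alternants, and such a sum is a Pfaffian. In the exterior algebra it is the top coefficient of
the n-th power of the 2-form with matrix K(x_i, x_j), divided by n!, where K(x, y) = ∑_{q' < p} f(p)
g(q') x^p y^q' is a rational function (`factorial_smul_altSum`, `factorial_mul_subst_z`). Staying
with powers of 2-forms and keeping the n! avoids defining Pfaffians.

Adjoin the arguments t and -t. Let p be the antisymmetrized kernel at (t, -t). The Schur complement
of that 2×2 block is again the antisymmetrized kernel at the x_i, multiplied by q h_i h_j with h_i =
(x_i² - t²)/(1 - q t² x_i²); this is `kernel_four_point`. Completing the square in the 2-form then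
gives, as top coefficient, (n+1) p q^n ∏ h_i times the previous one
(`topCoeff_matrixForm_recursion`).

On the other side V gains 2t ∏ (x_i² - t²) and the constant gains q^n. The ratio is (p / 2t) ∏ 1/(1
- q t² x_i²), and p / 2t = (1 - ac t²)/((1 - ab t²)(1 - q t⁴)). The cancellations take place over
ℤ[a, b, c, d]; any other ring follows by specialization. -/

/-- Strictly decreasing sequences of length `m` with entries smaller than `L`. -/
def decSeq (L m : ℕ) : Finset (Fin m → ℕ) :=
  {l ∈ Fintype.piFinset fun _ => range L | StrictAnti l}

theorem mem_decSeq {L m : ℕ} {l : Fin m → ℕ} :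
    l ∈ decSeq L m ↔ (∀ k, l k < L) ∧ StrictAnti l := by
  simp [decSeq]

theorem strictAnti_cons {m : ℕ} {p : ℕ} {l : Fin m → ℕ} :
    StrictAnti (Fin.cons p l : Fin (m + 1) → ℕ) ↔ (∀ k, l k < p) ∧ StrictAnti l := by
  constructor
  · intro h
    exact ⟨fun k => by simpa using h (Fin.succ_pos k),
      fun i j hij => by simpa using h (Fin.succ_lt_succ_iff.mpr hij)⟩
  · rintro ⟨h1, h2⟩ i j
    refine Fin.cases ?_ (fun i => ?_) i <;> refine Fin.cases ?_ (fun j => ?_) j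
    · simp
    · intro _; simpa using h1 j
    · simp
    · intro hij; simpa using h2 (Fin.succ_lt_succ_iff.mp hij)

theorem sum_decSeq_succ {A : Type*} [AddCommMonoid A] (L m : ℕ) (F : (Fin (m + 1) → ℕ) → A) :
    ∑ l ∈ decSeq L (m + 1), F l = ∑ p ∈ range L, ∑ l ∈ decSeq p m, F (Fin.cons p l) := by
  rw [sum_sigma']
  refine sum_bij' (fun l _ => ⟨l 0, Fin.tail l⟩)
    (fun s _ => (Fin.cons s.1 s.2 : Fin (m + 1) → ℕ)) ?_ ?_ ?_ ?_ ?_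
  · intro l hl
    obtain ⟨h1, h2⟩ := mem_decSeq.mp hl
    rw [← Fin.cons_self_tail l, strictAnti_cons] at h2
    simpa [mem_decSeq, h1 0] using h2
  · rintro ⟨p, l⟩ h
    simp only [mem_sigma, mem_range, mem_decSeq] at h
    refine mem_decSeq.mpr ⟨fun k => ?_, strictAnti_cons.mpr h.2⟩
    refine Fin.cases ?_ (fun k => ?_) k
    · simpa using h.1
    · simpa using (h.2.1 k).trans h.1
  · intro l _
    simp
  · rintro ⟨p, l⟩ _
    simp
  · intro l _
    simp

/-! ### Weighted sums of exterior products -/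

section Weight

variable {S : Type*} [CommRing S] (f g : ℕ → S)

/-- The product `… f(l₁) g(l₂)` of alternating weights, where the last entry carries `g`. -/
def altWeight {m : ℕ} (l : Fin m → ℕ) : S :=
  ∏ k, if Even (m - k.val) then f (l k) else g (l k)

theorem altWeight_cons {m : ℕ} (p : ℕ) (l : Fin m → ℕ) :
    altWeight f g (Fin.cons p l : Fin (m + 1) → ℕ) =
      (if Even (m + 1) then f p else g p) * altWeight f g l := by
  simp [altWeight, Fin.prod_univ_succ]

variable {M : Type*} [AddCommGroup M] [Module S M] (ψ : ℕ → M)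

/-- The weighted sum of the exterior products of `m` distinct vectors among `ψ 0, …, ψ (L - 1)`. -/
noncomputable def altSum (L m : ℕ) : ExteriorAlgebra S M :=
  ∑ l ∈ decSeq L m, altWeight f g l • ExteriorAlgebra.ιMulti S m (fun k => ψ (l k))

theorem altSum_zero_right (L : ℕ) : altSum f g ψ L 0 = 1 := by
  have : decSeq L 0 = {Fin.elim0} := by
    ext l
    simp [mem_decSeq, Subsingleton.elim l Fin.elim0, StrictAnti]
  simp [altSum, this, altWeight]

theorem altSum_succ_right (L m : ℕ) : altSum f g ψ L (m + 1) =
    ∑ p ∈ range L, (if Even (m + 1) then f p else g p) •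
      (ExteriorAlgebra.ι S (ψ p) * altSum f g ψ p m) := by
  rw [altSum, sum_decSeq_succ]
  refine sum_congr rfl fun p _ => ?_
  rw [altSum, mul_sum, smul_sum]
  refine sum_congr rfl fun l _ => ?_
  rw [altWeight_cons, ExteriorAlgebra.ιMulti_succ_apply, mul_smul_comm, smul_smul]
  simp [Matrix.vecTail, Function.comp_def]

theorem altSum_succ_succ (L m : ℕ) : altSum f g ψ (L + 1) (m + 1) =
    altSum f g ψ L (m + 1) + (if Even (m + 1) then f L else g L) •
      (ExteriorAlgebra.ι S (ψ L) * altSum f g ψ L m) := by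
  rw [altSum_succ_right, sum_range_succ, ← altSum_succ_right]

/-- `∑_{q < L} g(q) ψ_q`. -/
noncomputable def weightedVec (L : ℕ) : M := ∑ q ∈ range L, g q • ψ q

/-- `∑_{q < p < L} f(p) g(q) ψ_p ∧ ψ_q`. -/
noncomputable def weightedForm (L : ℕ) : ExteriorAlgebra S M :=
  ∑ p ∈ range L, f p • (ExteriorAlgebra.ι S (ψ p) * ExteriorAlgebra.ι S (weightedVec g ψ p))

end Weight

/-! ### Products of two vectors: central and of square zero -/

section Even

variable {S : Type*} [CommRing S] {M : Type*} [AddCommGroup M] [Module S M]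

open ExteriorAlgebra

theorem ι_mul_ι_swap (x y : M) : ι S x * ι S y = -(ι S y * ι S x) :=
  eq_neg_of_add_eq_zero_left (ι_add_mul_swap x y)

theorem commute_ι_mul_ι_ι (x y v : M) : Commute (ι S x * ι S y) (ι S v) := by
  rw [Commute, SemiconjBy, mul_assoc, ι_mul_ι_swap y v, mul_neg, ← mul_assoc, ι_mul_ι_swap x v,
    neg_mul, neg_neg, mul_assoc]

theorem commute_ι_mul_ι (x y : M) (u : ExteriorAlgebra S M) : Commute (ι S x * ι S y) u := by
  induction u using ExteriorAlgebra.induction with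
  | algebraMap r => exact (Algebra.commutes r _).symm
  | ι v => exact commute_ι_mul_ι_ι x y v
  | mul a b ha hb => exact ha.mul_right hb
  | add a b ha hb => exact ha.add_right hb

theorem ι_mul_ι_mul_self (x y : M) : (ι S x * ι S y) * (ι S x * ι S y) = 0 := by
  rw [← mul_assoc (ι S x * ι S y), (commute_ι_mul_ι x y (ι S x)).eq, ← mul_assoc, ι_sq_zero,
    zero_mul, zero_mul]

theorem add_pow_succ_of_sq_eq_zero {A : Type*} [Ring A] {u e : A} (hc : Commute e u)
    (he : e * e = 0) (n : ℕ) : (u + e) ^ (n + 1) = u ^ (n + 1) + (n + 1) • (e * u ^ n) := by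
  induction n with
  | zero => simp
  | succ n ih =>
    have h : e * u ^ n * e = 0 := by
      rw [mul_assoc, ← (hc.pow_right n).eq, ← mul_assoc, he, zero_mul]
    rw [pow_succ, ih, add_mul, mul_add, mul_add, ← pow_succ, ← (hc.pow_right (n + 1)).eq,
      smul_mul_assoc, smul_mul_assoc, h, smul_zero, add_zero, mul_assoc e, ← pow_succ,
      succ_nsmul (e * u ^ (n + 1)) (n + 1)]
    abel

end Even

/-! ### Minor summation as a power of a 2-form -/

section Pfaffian

variable {S : Type*} [CommRing S] {M : Type*} [AddCommGroup M] [Module S M]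
  (f g : ℕ → S) (ψ : ℕ → M)

open ExteriorAlgebra

theorem weightedForm_succ (L : ℕ) : weightedForm f g ψ (L + 1) =
    weightedForm f g ψ L + ι S (f L • ψ L) * ι S (weightedVec g ψ L) := by
  simp [weightedForm, sum_range_succ]

/-- Raising L by one adds e = f(L) ψ_L ∧ v to the form, where v is `weightedVec`. Since e is central
with e² = 0, the n-th power gains just n e A^(n-1), which matches the sequences starting with L.
Removing that first entry changes the parity of the length, so both parities are proved together. -/
theorem factorial_smul_altSum (L n : ℕ) :
    n.factorial • altSum f g ψ L (2 * n) = weightedForm f g ψ L ^ n ∧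
    n.factorial • altSum f g ψ L (2 * n + 1) =
      ι S (weightedVec g ψ L) * weightedForm f g ψ L ^ n := by
  induction L generalizing n with
  | zero =>
    have h1 : ∀ m, altSum f g ψ 0 (m + 1) = 0 := fun m => by simp [altSum_succ_right]
    refine ⟨?_, by simp [h1, weightedVec]⟩
    cases n with
    | zero => simp [altSum_zero_right]
    | succ n => simp [mul_add, h1, weightedForm]
  | succ L ih =>
    set A := weightedForm f g ψ L with hA
    set v := weightedVec g ψ L with hv
    set e := ι S (f L • ψ L) * ι S v with he
    have hee : e * e = 0 := ι_mul_ι_mul_self _ _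
    have hc : Commute e A := commute_ι_mul_ι _ _ _
    have hev : ι S v * e = 0 := by
      rw [← (commute_ι_mul_ι _ _ _).eq, mul_assoc, ι_sq_zero, mul_zero]
    have hpe : ι S (ψ L) * e = 0 := by
      rw [he, map_smul, smul_mul_assoc, mul_smul_comm, ← mul_assoc, ι_sq_zero, zero_mul, smul_zero]
    -- For n = 0 the truncated exponent is harmless: its term has coefficient 0.
    have key : weightedForm f g ψ (L + 1) ^ n = A ^ n + n • (e * A ^ (n - 1)) := by
      rw [weightedForm_succ]
      cases n with
      | zero => simp
      | succ n => exact add_pow_succ_of_sq_eq_zero hc hee n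
    constructor
    · rw [key]
      cases n with
      | zero => simp [altSum_zero_right]
      | succ n =>
        rw [show 2 * (n + 1) = 2 * n + 1 + 1 by ring, altSum_succ_succ, smul_add,
          show 2 * n + 1 + 1 = 2 * (n + 1) by ring, (ih _).1, if_pos (by simp), Nat.factorial_succ,
          mul_smul, smul_comm n.factorial, ← mul_smul_comm, (ih _).2, he]
        simp [mul_assoc]
    · rw [altSum_succ_succ, smul_add, (ih _).2, if_neg (by simp), smul_comm n.factorial,
        ← mul_smul_comm, (ih _).1, key, weightedVec, sum_range_succ, ← weightedVec, ← hv, map_add,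
        map_smul, add_mul, mul_add, smul_mul_assoc, mul_add]
      simp only [mul_smul_comm, ← mul_assoc, hev, hpe]
      simp

end Pfaffian

/-! ### Top coefficients and Pfaffian condensation -/

section TopCoeff

variable {S : Type*} [CommRing S]

open ExteriorAlgebra

/-- The coefficient of `θ₁ ∧ ⋯ ∧ θ_N` in the exterior algebra of `S^N`. -/
noncomputable def topCoeff (N : ℕ) : ExteriorAlgebra S (Fin N → S) →ₗ[S] S :=
  liftAlternating (Pi.single N Matrix.detRowAlternating)

theorem topCoeff_ιMulti (N : ℕ) (v : Fin N → Fin N → S) :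
    topCoeff N (ιMulti S N v) = Matrix.det (Matrix.of v) := by
  rw [topCoeff, liftAlternating_apply_ιMulti, Pi.single_eq_same]
  rfl

/-- The element `∑ᵢⱼ B i j θᵢ ∧ θⱼ` of the exterior algebra of `S^N`. -/
noncomputable def matrixForm {N : ℕ} (B : Fin N → Fin N → S) : ExteriorAlgebra S (Fin N → S) :=
  ∑ i, ∑ j, B i j • (ι S (Pi.single i 1) * ι S (Pi.single j 1))

theorem matrixForm_pow_mem {N : ℕ} (B : Fin N → Fin N → S) (n : ℕ) :
    matrixForm B ^ n ∈ ⋀[S]^(2 * n) (Fin N → S) := by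
  have h : matrixForm B ∈ ⋀[S]^2 (Fin N → S) := by
    refine sum_mem fun i _ => sum_mem fun j _ => Submodule.smul_mem _ _ ?_
    rw [exteriorPower, pow_two]
    exact Submodule.mul_mem_mul ⟨_, rfl⟩ ⟨_, rfl⟩
  rw [exteriorPower, pow_mul]
  exact Submodule.pow_mem_pow _ h n

theorem eq_of_mem_exteriorPower {M P : Type*} [AddCommGroup M] [Module S M] [AddCommGroup P]
    [Module S P] {F G : ExteriorAlgebra S M →ₗ[S] P} {k : ℕ}
    (h : ∀ v, F (ιMulti S k v) = G (ιMulti S k v)) {u : ExteriorAlgebra S M}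
    (hu : u ∈ ⋀[S]^k M) : F u = G u := by
  rw [← ιMulti_span_fixedDegree] at hu
  refine LinearMap.eqOn_span ?_ hu
  rintro _ ⟨v, rfl⟩
  exact h v

/-- The terms at (i, j) and (j, i) cancel, and the diagonal ones vanish because ι(v)² = 0, so no
division by 2 is needed. Thus a 2-form depends only on the differences D i j - D j i. -/
theorem sum_symmetric_smul_ι_mul_ι {M κ : Type*} [Fintype κ] [AddCommGroup M] [Module S M]
    (v : κ → M) (D : κ → κ → S) (hD : ∀ i j, D i j = D j i) :
    ∑ i, ∑ j, D i j • (ι S (v i) * ι S (v j)) = 0 := by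
  rw [← Fintype.sum_prod_type' (f := fun i j => D i j • (ι S (v i) * ι S (v j)))]
  refine sum_involution (fun p _ => p.swap) ?_ ?_ ?_ ?_
  · rintro ⟨i, j⟩ _
    simp only [Prod.swap]
    rw [hD j i, ← smul_add, ι_add_mul_swap, smul_zero]
  · rintro ⟨i, j⟩ _ h e
    obtain ⟨h1, -⟩ := Prod.ext_iff.mp e
    simp only [Prod.swap] at h1
    subst h1
    simp at h
  · simp
  · simp

theorem sum_smul_ι_mul_ι_congr {M κ : Type*} [Fintype κ] [AddCommGroup M] [Module S M]
    (v : κ → M) (D D' : κ → κ → S) (hD : ∀ i j, D i j - D j i = D' i j - D' j i) :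
    ∑ i, ∑ j, D i j • (ι S (v i) * ι S (v j)) = ∑ i, ∑ j, D' i j • (ι S (v i) * ι S (v j)) := by
  rw [← sub_eq_zero]
  simp only [← sum_sub_distrib, ← sub_smul]
  refine sum_symmetric_smul_ι_mul_ι v _ fun i j => ?_
  linear_combination hD i j

theorem det_of_first_column_eq_zero {n : ℕ} (A : Matrix (Fin (n + 1)) (Fin (n + 1)) S)
    (h : ∀ i : Fin n, A i.succ 0 = 0) :
    A.det = A 0 0 * (A.submatrix Fin.succ Fin.succ).det := by
  rw [Matrix.det_succ_column_zero, Fin.sum_univ_succ]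
  simp [h]

/-- The map `S^N → S^(N+2)` which scales the coordinates by `h` and prepends two zeros. -/
def scaleShift {N : ℕ} (h : Fin N → S) : (Fin N → S) →ₗ[S] (Fin (N + 1 + 1) → S) where
  toFun v := Fin.cons 0 (Fin.cons 0 fun i => h i * v i)
  map_add' v w := by
    ext k
    refine Fin.cases ?_ (fun k => Fin.cases ?_ (fun k => ?_) k) k <;> simp [mul_add]
  map_smul' r v := by
    ext k
    refine Fin.cases ?_ (fun k => Fin.cases ?_ (fun k => ?_) k) k <;> simp [mul_left_comm]

theorem scaleShift_single {N : ℕ} (h : Fin N → S) (i : Fin N) :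
    scaleShift h (Pi.single i 1) = h i • Pi.single i.succ.succ 1 := by
  ext k
  refine Fin.cases ?_ (fun k => Fin.cases ?_ (fun k => ?_) k) k
  · simp [scaleShift]
  · simp [scaleShift, Pi.single_apply, Fin.ext_iff]
  · by_cases e : k = i <;> simp [scaleShift, e, Pi.single_apply]

theorem topCoeff_map_scaleShift {N : ℕ} (h : Fin N → S) {u : ExteriorAlgebra S (Fin N → S)}
    (hu : u ∈ ⋀[S]^(N + 1 + 1) (Fin N → S)) :
    topCoeff (N + 1 + 1) (map (scaleShift h) u) = 0 := by
  refine eq_of_mem_exteriorPower (F := topCoeff (N + 1 + 1) ∘ₗ (map (scaleShift h)).toLinearMap)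
    (G := 0) (fun v => ?_) hu
  simp only [LinearMap.comp_apply, AlgHom.toLinearMap_apply, map_apply_ιMulti, topCoeff_ιMulti]
  exact Matrix.det_eq_zero_of_column_eq_zero 0 fun i => by simp [scaleShift]

/-- The determinant with rows x, y and the shifted vectors is block triangular, and the scaling by h
pulls out of its columns. -/
theorem topCoeff_mul_map_scaleShift {N : ℕ} (h : Fin N → S) (x y : Fin (N + 1 + 1) → S)
    (hy : y 0 = 0) {u : ExteriorAlgebra S (Fin N → S)}
    (hu : u ∈ ⋀[S]^N (Fin N → S)) :
    topCoeff (N + 1 + 1) (ι S x * ι S y * map (scaleShift h) u) =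
      x 0 * y (Fin.succ 0) * (∏ i, h i) * topCoeff N u := by
  refine eq_of_mem_exteriorPower
    (F := topCoeff (N + 1 + 1) ∘ₗ LinearMap.mulLeft S (ι S x * ι S y) ∘ₗ
      (map (scaleShift h)).toLinearMap)
    (G := (x 0 * y (Fin.succ 0) * (∏ i, h i)) • topCoeff N) (fun v => ?_) hu
  have e : ι S x * ι S y * ιMulti S N (scaleShift h ∘ v) =
      ιMulti S (N + 1 + 1) (Fin.cons x (Fin.cons y (scaleShift h ∘ v))) := by
    rw [ιMulti_succ_apply, ιMulti_succ_apply, mul_assoc]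
    rfl
  simp only [LinearMap.comp_apply, AlgHom.toLinearMap_apply, map_apply_ιMulti,
    LinearMap.mulLeft_apply, e, topCoeff_ιMulti, LinearMap.smul_apply, smul_eq_mul]
  rw [det_of_first_column_eq_zero, det_of_first_column_eq_zero]
  · have e2 : ((Matrix.of (Fin.cons x (Fin.cons y (scaleShift h ∘ v)))).submatrix
        Fin.succ Fin.succ).submatrix Fin.succ Fin.succ =
        Matrix.of fun i j => h j * Matrix.of v i j := by
      ext i j
      simp [scaleShift]
    rw [e2, Matrix.det_mul_row]
    simp only [Matrix.of_apply, Matrix.submatrix_apply, Fin.cons_zero, Fin.cons_succ]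
    ring
  · intro i
    simp [scaleShift]
  · intro i
    refine Fin.cases ?_ (fun i => ?_) i <;> simp [scaleShift, hy]

theorem matrixForm_succ_succ {N : ℕ} (B : Fin (N + 1 + 1) → Fin (N + 1 + 1) → S) :
    matrixForm B = (B 0 1 - B 1 0) • (ι S (Pi.single 0 1) * ι S (Pi.single 1 1)) +
      ι S (Pi.single 0 1) * ι S (∑ i : Fin N,
        (B 0 i.succ.succ - B i.succ.succ 0) • Pi.single i.succ.succ 1) +
      ι S (Pi.single 1 1) * ι S (∑ i : Fin N,
        (B 1 i.succ.succ - B i.succ.succ 1) • Pi.single i.succ.succ 1) +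
      ∑ i : Fin N, ∑ j : Fin N, B i.succ.succ j.succ.succ •
        (ι S (Pi.single i.succ.succ 1) * ι S (Pi.single j.succ.succ 1)) := by
  rw [matrixForm]
  simp only [Fin.sum_univ_succ (n := N + 1), Fin.sum_univ_succ (n := N), sum_add_distrib,
    Fin.succ_zero_eq_one, ι_sq_zero, smul_zero, map_sum, map_smul, sub_smul, sum_sub_distrib,
    map_sub, mul_sub, mul_sum, mul_smul_comm]
  rw [ι_mul_ι_swap (Pi.single 1 1) (Pi.single 0 1)]
  simp only [ι_mul_ι_swap (Pi.single (Fin.succ (Fin.succ _)) 1) (Pi.single 1 1),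
    ι_mul_ι_swap (Pi.single (Fin.succ (Fin.succ _)) 1) (Pi.single 0 1), smul_neg,
    sum_neg_distrib]
  abel

/-- Hypothesis `hB` says that the Schur complement of the leading 2×2 block is the remaining block
rescaled by r h_i h_j. The square is completed after multiplying by p = B 0 1 - B 1 0, which need
not be invertible; hence the common factor p^(n+1). -/
theorem topCoeff_matrixForm_recursion (n : ℕ)
    (B : Fin (2 * n + 1 + 1) → Fin (2 * n + 1 + 1) → S) (r : S) (h : Fin (2 * n) → S)
    (hB : ∀ i j : Fin (2 * n),
      (B 0 1 - B 1 0) * (B i.succ.succ j.succ.succ - B j.succ.succ i.succ.succ) -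
        ((B 0 i.succ.succ - B i.succ.succ 0) * (B 1 j.succ.succ - B j.succ.succ 1) -
          (B 0 j.succ.succ - B j.succ.succ 0) * (B 1 i.succ.succ - B i.succ.succ 1)) =
      (B 0 1 - B 1 0) * r * h i * h j *
        (B i.succ.succ j.succ.succ - B j.succ.succ i.succ.succ)) :
    (B 0 1 - B 1 0) ^ (n + 1) * topCoeff (2 * n + 1 + 1) (matrixForm B ^ (n + 1)) =
      (B 0 1 - B 1 0) ^ (n + 1) * ((n + 1) * (B 0 1 - B 1 0) * r ^ n * (∏ i, h i) *
        topCoeff (2 * n) (matrixForm (fun i j => B i.succ.succ j.succ.succ) ^ n)) := by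
  set p := B 0 1 - B 1 0 with hp
  set α : Fin (2 * n + 1 + 1) → S := ∑ i : Fin (2 * n),
        (B 0 i.succ.succ - B i.succ.succ 0) • Pi.single i.succ.succ 1 with hα
  set β : Fin (2 * n + 1 + 1) → S := ∑ i : Fin (2 * n),
        (B 1 i.succ.succ - B i.succ.succ 1) • Pi.single i.succ.succ 1 with hβ
  set A := matrixForm fun i j => B i.succ.succ j.succ.succ with hA
  set e := ι S (p • Pi.single 0 1 - β) * ι S (p • Pi.single 1 1 + α) with he
  have h1 : p • (∑ i : Fin (2 * n), ∑ j : Fin (2 * n), B i.succ.succ j.succ.succ •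
        (ι S (Pi.single i.succ.succ (1 : S) : Fin (2 * n + 1 + 1) → S) *
          ι S (Pi.single j.succ.succ 1))) - ι S α * ι S β =
      (p * r) • map (scaleShift h) A := by
    have h2 : ι S α * ι S β = ∑ i : Fin (2 * n), ∑ j : Fin (2 * n),
        ((B 0 i.succ.succ - B i.succ.succ 0) * (B 1 j.succ.succ - B j.succ.succ 1)) •
        (ι S (Pi.single i.succ.succ (1 : S) : Fin (2 * n + 1 + 1) → S) *
          ι S (Pi.single j.succ.succ 1)) := by
      simp only [hα, hβ, map_sum, map_smul, sum_mul_sum, smul_mul_smul_comm]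
    have h3 : (p * r) • map (scaleShift h) A = ∑ i : Fin (2 * n), ∑ j : Fin (2 * n),
        (p * r * h i * h j * B i.succ.succ j.succ.succ) •
        (ι S (Pi.single i.succ.succ (1 : S) : Fin (2 * n + 1 + 1) → S) *
          ι S (Pi.single j.succ.succ 1)) := by
      simp only [hA, matrixForm, map_sum, map_smul, map_mul, map_apply_ι, scaleShift_single,
        smul_mul_smul_comm, smul_sum, smul_smul]
      refine sum_congr rfl fun i _ => sum_congr rfl fun j _ => ?_
      congr 1
      ring
    rw [h2, h3, smul_sum, ← sum_sub_distrib]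
    simp only [smul_sum, smul_smul, ← sum_sub_distrib, ← sub_smul]
    refine sum_smul_ι_mul_ι_congr _ _ _ fun i j => ?_
    linear_combination hB i j
  -- Expanding e = (p θ₀ - β)(p θ₁ + α) gives all terms containing θ₀ or θ₁, plus αβ, which `h1`
  -- compensates. As e² = 0, only two terms of the power survive; the one without e has degree 2n +
  -- 2 in 2n vectors and drops out.
  have h4 : p • matrixForm B = (p * r) • map (scaleShift h) A + e := by
    rw [matrixForm_succ_succ, ← h1, he, ← hp, ← hα, ← hβ]
    simp only [map_sub, map_add, map_smul, sub_mul, mul_add, smul_add, smul_mul_assoc,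
      mul_smul_comm, ι_mul_ι_swap β]
    module
  have h5 : (p • matrixForm B) ^ (n + 1) = (p * r) ^ (n + 1) • map (scaleShift h) (A ^ (n + 1)) +
      (n + 1) • ((p * r) ^ n • (e * map (scaleShift h) (A ^ n))) := by
    rw [h4, add_pow_succ_of_sq_eq_zero (commute_ι_mul_ι _ _ _) (ι_mul_ι_mul_self _ _),
      smul_pow, smul_pow, mul_smul_comm, map_pow, map_pow]
  have h6 := congrArg (topCoeff (2 * n + 1 + 1)) h5
  rw [smul_pow, map_add, map_smul, map_smul, map_nsmul, map_smul,
    topCoeff_map_scaleShift h (matrixForm_pow_mem _ (n + 1)), he,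
    topCoeff_mul_map_scaleShift h _ _ _ (u := A ^ n) (matrixForm_pow_mem _ n)] at h6
  · simp only [smul_eq_mul, nsmul_eq_mul] at h6
    rw [h6]
    have h7 : ∀ i : Fin (2 * n), (1 : Fin (2 * n + 1 + 1)) ≠ i.succ.succ := fun i => by
      simp [Fin.ext_iff]
    have hα1 : α 1 = 0 := by simp [hα, h7]
    have hβ0 : β 0 = 0 := by simp [hβ]
    simp only [Pi.sub_apply, Pi.add_apply, Pi.smul_apply, hα1, hβ0, Fin.succ_zero_eq_one,
      Pi.single_eq_same, smul_eq_mul, Nat.cast_add, Nat.cast_one]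
    generalize topCoeff (2 * n) (A ^ n) = T
    clear_value p
    ring
  · simp [hα]

end TopCoeff

/-! ### The generating function of the weights -/

section Kernel

variable {S : Type*} [CommRing S]

/-- The weight `a^⌈(p-1)/2⌉ b^⌊(p-1)/2⌋` of an odd-numbered entry of `λ + δ`. -/
def oddWeight (a b : S) (p : ℕ) : S := a ^ (p / 2) * b ^ ((p - 1) / 2)

/-- The weight `c^⌈q/2⌉ d^⌊q/2⌋` of an even-numbered entry of `λ + δ`. -/
def evenWeight (c d : S) (q : ℕ) : S := c ^ ((q + 1) / 2) * d ^ (q / 2)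

/-- The recursion with step 2 starts at p = 1 only: truncated subtraction makes the value at 0 equal
to 1. That value plays no role in the kernel, where p > q ≥ 0. -/
theorem oddWeight_add_three (a b : S) (p : ℕ) :
    oddWeight a b (p + 3) = a * b * oddWeight a b (p + 1) := by
  rw [oddWeight, oddWeight, show (p + 3) / 2 = (p + 1) / 2 + 1 by omega,
    show (p + 3 - 1) / 2 = (p + 1 - 1) / 2 + 1 by omega]
  ring

theorem evenWeight_add_two (c d : S) (q : ℕ) :
    evenWeight c d (q + 2) = c * d * evenWeight c d q := by
  rw [evenWeight, evenWeight, show (q + 2 + 1) / 2 = (q + 1) / 2 + 1 by omega,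
    show (q + 2) / 2 = q / 2 + 1 by omega]
  ring

theorem one_sub_mul_sum_Ico {r : S} {u : ℕ → S} {m L : ℕ} (h : m ≤ L)
    (hu : ∀ k, m ≤ k → u (k + 2) = r * u k) :
    (1 - r) * ∑ k ∈ Ico m L, u k = u m + u (m + 1) - u L - u (L + 1) := by
  induction L, h using Nat.le_induction with
  | base => simp
  | succ L h ih =>
    rw [sum_Ico_succ_top h, mul_add, ih, hu L h]
    ring

/-- The truncated generating function `∑_{q < p < L} f(p) g(q) x^p y^q`. -/
def truncKernel (f g : ℕ → S) (L : ℕ) (x y : S) : S :=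
  ∑ p ∈ range L, ∑ q ∈ range p, f p * g q * (x ^ p * y ^ q)

/-- The numerator of the generating function `∑_{q < p} f(p) g(q) x^p y^q`. -/
def kernelNum (a b c x y : S) : S := x * (1 + a * x) + a * c * x ^ 2 * y * (1 + b * x)

theorem truncKernel_eq_sum_Ico (f g : ℕ → S) (L : ℕ) (x y : S) :
    truncKernel f g L x y =
      ∑ q ∈ range L, g q * y ^ q * ∑ p ∈ Ico (q + 1) L, f p * x ^ p := by
  rw [truncKernel, sum_comm' (t' := range L) (s' := fun q => Ico (q + 1) L)]
  · refine sum_congr rfl fun q _ => ?_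
    rw [mul_sum]
    refine sum_congr rfl fun p _ => ?_
    ring
  · intro p q
    simp only [mem_range, mem_Ico]
    omega

/-- Summing over p and then over q telescopes twice with step 2, with ratios ab x² and abcd x² y².
The lower boundary terms form the numerator; every upper one contains x^L or y^L. -/
theorem kernelNum_sub_mul_truncKernel_mem (a b c d x y : S) (J : Ideal S) (L : ℕ)
    (hx : x ^ L ∈ J) (hy : y ^ L ∈ J) :
    kernelNum a b c x y - (1 - a * b * x ^ 2) * (1 - a * b * c * d * x ^ 2 * y ^ 2) *
      truncKernel (oddWeight a b) (evenWeight c d) L x y ∈ J := by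
  set f := oddWeight a b with hf
  set g := evenWeight c d with hg
  have h1 : ∀ q ∈ range L, (1 - a * b * x ^ 2) * ∑ p ∈ Ico (q + 1) L, f p * x ^ p =
      f (q + 1) * x ^ (q + 1) + f (q + 2) * x ^ (q + 2) - f L * x ^ L
        - f (L + 1) * x ^ (L + 1) := by
    intro q hq
    refine one_sub_mul_sum_Ico (u := fun p => f p * x ^ p) (mem_range.mp hq) fun k hk => ?_
    obtain ⟨k, rfl⟩ := Nat.exists_eq_add_of_le' (Nat.le_of_add_left_le hk)
    simp only [hf, oddWeight_add_three, show k + 1 + 2 = k + 3 by rfl]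
    ring
  set u : ℕ → S := fun q => g q * y ^ q * (f (q + 1) * x ^ (q + 1) + f (q + 2) * x ^ (q + 2))
    with hu
  have h2 := one_sub_mul_sum_Ico (r := a * b * c * d * x ^ 2 * y ^ 2) (u := u) (Nat.zero_le L)
    fun k _ => by
      simp only [hu, hf, hg, evenWeight_add_two, oddWeight_add_three, show k + 2 + 1 = k + 3 by rfl,
        show k + 2 + 2 = k + 1 + 3 by rfl]
      ring
  have h3 : (1 - a * b * x ^ 2) * truncKernel f g L x y = ∑ q ∈ range L, u q -
      x ^ L * ∑ q ∈ range L, g q * y ^ q * (f L + f (L + 1) * x) := by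
    rw [truncKernel_eq_sum_Ico, mul_sum, mul_sum, ← sum_sub_distrib]
    refine sum_congr rfl fun q hq => ?_
    rw [mul_left_comm, h1 q hq, hu]
    ring
  have h0 : u 0 + u 1 = kernelNum a b c x y := by
    simp [hu, hf, hg, oddWeight, evenWeight, kernelNum]
    ring
  rw [range_eq_Ico] at h3
  have h4 : kernelNum a b c x y - (1 - a * b * x ^ 2) * (1 - a * b * c * d * x ^ 2 * y ^ 2) *
      truncKernel f g L x y =
      (g L * (f (L + 1) * x ^ (L + 1) + f (L + 2) * x ^ (L + 2)) +
        g (L + 1) * y * (f (L + 1 + 1) * x ^ (L + 1 + 1) + f (L + 1 + 2) * x ^ (L + 1 + 2))) *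
          y ^ L +
      ((1 - a * b * c * d * x ^ 2 * y ^ 2) *
        ∑ q ∈ Ico 0 L, g q * y ^ q * (f L + f (L + 1) * x)) * x ^ L := by
    have h5 : u L + u (L + 1) = (g L * (f (L + 1) * x ^ (L + 1) + f (L + 2) * x ^ (L + 2)) +
        g (L + 1) * y * (f (L + 1 + 1) * x ^ (L + 1 + 1) + f (L + 1 + 2) * x ^ (L + 1 + 2))) *
          y ^ L := by
      simp only [hu]
      ring
    rw [← h5, ← h0]
    linear_combination (-(1 - a * b * c * d * x ^ 2 * y ^ 2)) * h3 - h2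
  rw [h4]
  exact J.add_mem (J.mul_mem_left _ hy) (J.mul_mem_left _ hx)

/-- The generating function `∑_{q < p} f(p) g(q) x^p y^q` in closed form. -/
noncomputable def kernel (a b c d x y : S) : S :=
  kernelNum a b c x y *
    Ring.inverse ((1 - a * b * x ^ 2) * (1 - a * b * c * d * x ^ 2 * y ^ 2))

theorem mul_kernel {a b c d x y : S} (h1 : IsUnit (1 - a * b * x ^ 2))
    (h2 : IsUnit (1 - a * b * c * d * x ^ 2 * y ^ 2)) :
    (1 - a * b * x ^ 2) * (1 - a * b * c * d * x ^ 2 * y ^ 2) * kernel a b c d x y =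
      kernelNum a b c x y := by
  rw [kernel, mul_left_comm, Ring.mul_inverse_cancel _ (h1.mul h2), mul_one]

theorem kernel_sub_truncKernel_mem {a b c d x y : S} (h1 : IsUnit (1 - a * b * x ^ 2))
    (h2 : IsUnit (1 - a * b * c * d * x ^ 2 * y ^ 2)) {J : Ideal S} {L : ℕ}
    (hx : x ^ L ∈ J) (hy : y ^ L ∈ J) :
    kernel a b c d x y - truncKernel (oddWeight a b) (evenWeight c d) L x y ∈ J := by
  rw [← Ideal.unit_mul_mem_iff_mem J (h1.mul h2), mul_sub, mul_kernel h1 h2]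
  exact kernelNum_sub_mul_truncKernel_mem a b c d x y J L hx hy

theorem mul_kernel_sub_kernel {a b c d x y : S} (h1 : IsUnit (1 - a * b * x ^ 2))
    (h2 : IsUnit (1 - a * b * y ^ 2)) (h3 : IsUnit (1 - a * b * c * d * x ^ 2 * y ^ 2)) :
    (1 - a * b * x ^ 2) * (1 - a * b * y ^ 2) * (1 - a * b * c * d * x ^ 2 * y ^ 2) *
      (kernel a b c d x y - kernel a b c d y x) =
      kernelNum a b c x y * (1 - a * b * y ^ 2) - kernelNum a b c y x * (1 - a * b * x ^ 2) := by
  have h4 : IsUnit (1 - a * b * c * d * y ^ 2 * x ^ 2) := by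
    convert h3 using 1
    ring
  linear_combination (1 - a * b * y ^ 2) * mul_kernel h1 h3 - (1 - a * b * x ^ 2) * mul_kernel h2 h4

theorem mul_kernel_neg_sub_kernel {a b c d t : S} (h1 : IsUnit (1 - a * b * t ^ 2))
    (h2 : IsUnit (1 - a * b * c * d * t ^ 4)) :
    (1 - a * b * t ^ 2) * (1 - a * b * c * d * t ^ 4) *
      (kernel a b c d t (-t) - kernel a b c d (-t) t) = 2 * t * (1 - a * c * t ^ 2) := by
  have h := mul_kernel_sub_kernel (a := a) (b := b) (c := c) (d := d) (x := t) (y := -t) h1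
    (by simpa using h1) (by convert h2 using 1; ring)
  refine h1.mul_left_cancel ?_
  simp only [kernelNum] at h
  linear_combination h

/-- After clearing denominators two polynomial identities remain: `e6`, which factors 1 - abcd uv,
and `e7`, a Plücker-like relation among the numerators. -/
theorem kernel_four_point {a b c d t x y u v : S} (ht : IsUnit (1 - a * b * t ^ 2))
    (hx : IsUnit (1 - a * b * x ^ 2)) (hy : IsUnit (1 - a * b * y ^ 2))
    (htt : IsUnit (1 - a * b * c * d * t ^ 4))
    (htx : IsUnit (1 - a * b * c * d * t ^ 2 * x ^ 2))
    (hty : IsUnit (1 - a * b * c * d * t ^ 2 * y ^ 2))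
    (hxy : IsUnit (1 - a * b * c * d * x ^ 2 * y ^ 2))
    (hu : (1 - a * b * c * d * t ^ 2 * x ^ 2) * u = x ^ 2 - t ^ 2)
    (hv : (1 - a * b * c * d * t ^ 2 * y ^ 2) * v = y ^ 2 - t ^ 2) :
    (kernel a b c d t (-t) - kernel a b c d (-t) t) *
        (kernel a b c d x y - kernel a b c d y x) -
      ((kernel a b c d t x - kernel a b c d x t) *
          (kernel a b c d (-t) y - kernel a b c d y (-t)) -
        (kernel a b c d t y - kernel a b c d y t) *
          (kernel a b c d (-t) x - kernel a b c d x (-t))) =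
      (kernel a b c d t (-t) - kernel a b c d (-t) t) * (a * b * c * d) * u * v *
        (kernel a b c d x y - kernel a b c d y x) := by
  have e0 := mul_kernel_neg_sub_kernel ht htt
  have e1 := mul_kernel_sub_kernel hx hy hxy
  have e2 := mul_kernel_sub_kernel ht hx htx
  have e3 := mul_kernel_sub_kernel ht hy hty
  have e4 := mul_kernel_sub_kernel (c := c) (d := d) (x := -t) (y := x) (by simpa using ht) hx
    (by simpa using htx)
  have e5 := mul_kernel_sub_kernel (c := c) (d := d) (x := -t) (y := y) (by simpa using ht) hy
    (by simpa using hty)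
  rw [neg_sq] at e4 e5
  generalize kernel a b c d t (-t) - kernel a b c d (-t) t = p at *
  generalize kernel a b c d x y - kernel a b c d y x = w at *
  generalize kernel a b c d t x - kernel a b c d x t = p1 at *
  generalize kernel a b c d t y - kernel a b c d y t = p2 at *
  generalize kernel a b c d (-t) x - kernel a b c d x (-t) = p3 at *
  generalize kernel a b c d (-t) y - kernel a b c d y (-t) = p4 at *
  have e6 : (1 - a * b * c * d * t ^ 2 * x ^ 2) * (1 - a * b * c * d * t ^ 2 * y ^ 2) *
      (1 - a * b * c * d * u * v) =
      (1 - a * b * c * d * t ^ 4) * (1 - a * b * c * d * x ^ 2 * y ^ 2) := by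
    linear_combination (-(a * b * c * d) * (1 - a * b * c * d * t ^ 2 * y ^ 2) * v) * hu -
      a * b * c * d * (x ^ 2 - t ^ 2) * hv
  have e7 : 2 * t * (1 - a * c * t ^ 2) * (1 - a * b * t ^ 2) *
      (kernelNum a b c x y * (1 - a * b * y ^ 2) - kernelNum a b c y x * (1 - a * b * x ^ 2)) =
      (kernelNum a b c t x * (1 - a * b * x ^ 2) - kernelNum a b c x t * (1 - a * b * t ^ 2)) *
      (kernelNum a b c (-t) y * (1 - a * b * y ^ 2) -
        kernelNum a b c y (-t) * (1 - a * b * t ^ 2)) -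
      (kernelNum a b c t y * (1 - a * b * y ^ 2) - kernelNum a b c y t * (1 - a * b * t ^ 2)) *
      (kernelNum a b c (-t) x * (1 - a * b * x ^ 2) -
        kernelNum a b c x (-t) * (1 - a * b * t ^ 2)) := by
    simp only [kernelNum]
    ring
  rw [← e0, ← e1, ← e2, ← e3, ← e4, ← e5] at e7
  refine (((((ht.mul ht).mul hx).mul hy).mul htx).mul hty).mul_left_cancel ?_
  generalize 1 - a * b * c * d * t ^ 2 * x ^ 2 = E1 at *
  generalize 1 - a * b * c * d * t ^ 2 * y ^ 2 = E2 at *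
  generalize 1 - a * b * c * d * t ^ 4 = E3 at *
  generalize 1 - a * b * c * d * x ^ 2 * y ^ 2 = E4 at *
  generalize 1 - a * b * t ^ 2 = D1 at *
  generalize 1 - a * b * x ^ 2 = D2 at *
  generalize 1 - a * b * y ^ 2 = D3 at *
  linear_combination (D1 * D1 * D2 * D3 * p * w) * e6 + e7

end Kernel

/-! ### Passing from the truncated kernel to the full one -/

section Congruence

variable {S : Type*} [CommRing S] (J : Ideal S)

open ExteriorAlgebra

theorem map_mem_of_mem_smul_top {P Q : Type*} [AddCommGroup P] [Module S P] [AddCommGroup Q]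
    [Module S Q] (F : P →ₗ[S] Q) {u : P} (hu : u ∈ J • (⊤ : Submodule S P)) :
    F u ∈ J • (⊤ : Submodule S Q) := by
  have h := Submodule.mem_map_of_mem (f := F) hu
  rw [Submodule.map_smul''] at h
  exact Submodule.smul_mono le_rfl le_top h

theorem topCoeff_matrixForm_pow_sub_mem {N : ℕ} {B B' : Fin N → Fin N → S}
    (h : ∀ i j, B i j - B' i j ∈ J) (n : ℕ) :
    topCoeff N (matrixForm B ^ n) - topCoeff N (matrixForm B' ^ n) ∈ J := by
  have h1 : matrixForm B - matrixForm B' ∈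
      J • (⊤ : Submodule S (ExteriorAlgebra S (Fin N → S))) := by
    simp only [matrixForm, ← sum_sub_distrib, ← sub_smul]
    exact sum_mem fun i _ => sum_mem fun j _ => Submodule.smul_mem_smul (h i j) trivial
  have h2 : matrixForm B ^ n - matrixForm B' ^ n ∈
      J • (⊤ : Submodule S (ExteriorAlgebra S (Fin N → S))) := by
    induction n with
    | zero => simp
    | succ n ih =>
      have e : matrixForm B ^ (n + 1) - matrixForm B' ^ (n + 1) =
          (matrixForm B ^ n - matrixForm B' ^ n) * matrixForm B +
            matrixForm B' ^ n * (matrixForm B - matrixForm B') := by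
        rw [pow_succ, pow_succ, sub_mul, mul_sub]
        abel
      rw [e]
      exact add_mem (map_mem_of_mem_smul_top J (LinearMap.mulRight S (matrixForm B)) ih)
        (map_mem_of_mem_smul_top J (LinearMap.mulLeft S (matrixForm B' ^ n)) h1)
  rw [← map_sub]
  simpa using map_mem_of_mem_smul_top J (topCoeff N) h2

/-- For the power vectors ψ_p = (x_i^p)_i the exterior products encode alternants, so this links
minor summation with the kernel. -/
theorem weightedForm_powers {N : ℕ} (f g : ℕ → S) (x : Fin N → S) (L : ℕ) :
    weightedForm f g (fun p i => x i ^ p) L =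
      matrixForm fun i j => truncKernel f g L (x i) (x j) := by
  have h : ∀ p, ι S (fun i => x i ^ p) = ∑ i, x i ^ p • ι S (Pi.single i (1 : S)) := by
    intro p
    simp only [← map_smul, ← map_sum]
    congr 1
    exact pi_eq_sum_univ' _
  have h2 : ∀ p q, ι S (fun i => x i ^ p) * ι S (fun i => x i ^ q) =
      ∑ i, ∑ j, (x i ^ p * x j ^ q) • (ι S (Pi.single i (1 : S)) * ι S (Pi.single j (1 : S))) := by
    intro p q
    simp only [h, sum_mul_sum, smul_mul_smul_comm]
  simp only [weightedForm, weightedVec, matrixForm, truncKernel, sum_smul, map_sum, map_smul,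
    mul_sum, mul_smul_comm, h2, smul_sum, smul_smul, mul_assoc]
  symm
  rw [sum_congr rfl fun i _ => sum_comm, sum_comm]
  refine sum_congr rfl fun p _ => ?_
  rw [sum_congr rfl fun i _ => sum_comm, sum_comm]

/-- The minor summation formula for the alternating product weight, modulo an ideal which contains
large powers of the arguments. -/
theorem factorial_mul_sum_decSeq_sub_mem {n L : ℕ} {a b c d : S} {x : Fin (2 * n) → S}
    (h1 : ∀ i, IsUnit (1 - a * b * x i ^ 2))
    (h2 : ∀ i j, IsUnit (1 - a * b * c * d * x i ^ 2 * x j ^ 2)) (hx : ∀ i, x i ^ L ∈ J) :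
    n.factorial * ∑ l ∈ decSeq L (2 * n), altWeight (oddWeight a b) (evenWeight c d) l *
        Matrix.det (Matrix.of fun i j => x i ^ l j) -
      topCoeff (2 * n) (matrixForm (fun i j => kernel a b c d (x i) (x j)) ^ n) ∈ J := by
  have e : n.factorial * ∑ l ∈ decSeq L (2 * n), altWeight (oddWeight a b) (evenWeight c d) l *
        Matrix.det (Matrix.of fun i j => x i ^ l j) = topCoeff (2 * n) (matrixForm (fun i j =>
      truncKernel (oddWeight a b) (evenWeight c d) L (x i) (x j)) ^ n) := by
    rw [← weightedForm_powers, ← (factorial_smul_altSum _ _ _ L n).1, map_nsmul, nsmul_eq_mul,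
      altSum, map_sum]
    congr 1
    refine sum_congr rfl fun l _ => ?_
    rw [map_smul, topCoeff_ιMulti, smul_eq_mul, ← Matrix.det_transpose]
    rfl
  rw [e, ← neg_mem_iff, neg_sub]
  exact topCoeff_matrixForm_pow_sub_mem J
    (fun i j => kernel_sub_truncKernel_mem (h1 i) (h2 i j) (hx i) (hx j)) n

end Congruence

/-! ### Stanley's weight against the alternating product weight -/

section Weights

variable {S : Type*} [CommRing S]

/-- The quotient of the alternating product weight of `λ + δ` by Stanley's weight of `λ`. -/
def staircaseWeight (a b c d : S) (n : ℕ) : S :=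
  ∏ k : Fin (2 * n), (if Even k.val then a * b else c * d) ^ ((2 * n - 1 - k) / 2)

theorem staircaseWeight_succ (a b c d : S) (n : ℕ) :
    staircaseWeight a b c d (n + 1) = (a * b * c * d) ^ n * staircaseWeight a b c d n := by
  change ∏ k : Fin (2 * n + 1 + 1), _ = _
  rw [Fin.prod_univ_succ, Fin.prod_univ_succ, ← mul_assoc, staircaseWeight]
  congr 1
  · simp only [Fin.val_zero, Fin.val_succ, Even.zero, if_true, zero_add, Nat.not_even_one, if_false]
    rw [show (2 * (n + 1) - 1 - 0) / 2 = n by omega, show (2 * (n + 1) - 1 - 1) / 2 = n by omega]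
    ring
  · refine prod_congr rfl fun k _ => ?_
    rw [Fin.val_succ, Fin.val_succ, show 2 * (n + 1) - 1 - (k.val + 1 + 1) = 2 * n - 1 - k by omega]
    simp [Nat.even_add_one]

/-- The shift 2n - 1 - k is odd for even k and even for odd k. This parity makes the rounded halves
of λ_k plus its shift split into the exponents of ω and a part independent of λ. -/
theorem altWeight_add_staircase (a b c d : S) (n : ℕ) (lam : Fin (2 * n) → ℕ) :
    altWeight (oddWeight a b) (evenWeight c d) (fun j => lam j + (2 * n - 1 - j)) =
      staircaseWeight a b c d n * omegaWeight a b c d lam := by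
  simp only [omegaWeight, ← prod_pow_eq_pow_sum, prod_filter, staircaseWeight, altWeight,
    ← prod_mul_distrib]
  refine prod_congr rfl fun k _ => ?_
  have hk := k.isLt
  rcases Nat.even_or_odd k.val with h | h
  · have h1 : Even (2 * n - k.val) := by
      rw [Nat.even_sub hk.le]
      simp [h]
    obtain ⟨i, hi⟩ := h
    rw [if_pos h1, if_pos ⟨i, hi⟩, if_pos ⟨i, hi⟩, if_pos ⟨i, hi⟩,
      if_neg (Nat.not_odd_iff_even.mpr ⟨i, hi⟩), if_neg (Nat.not_odd_iff_even.mpr ⟨i, hi⟩),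
      oddWeight]
    rw [show (lam k + (2 * n - 1 - k.val)) / 2 = (lam k + 1) / 2 + (2 * n - 1 - k.val) / 2 by omega,
      show (lam k + (2 * n - 1 - k.val) - 1) / 2 = lam k / 2 + (2 * n - 1 - k.val) / 2 by omega]
    ring
  · have h1 : ¬ Even (2 * n - k.val) := by
      rw [Nat.even_sub hk.le]
      simpa using h
    have h2 := Nat.not_even_iff_odd.mpr h
    obtain ⟨i, hi⟩ := h
    rw [if_neg h1, if_neg h2, if_neg h2, if_neg h2, if_pos ⟨i, hi⟩, if_pos ⟨i, hi⟩, evenWeight]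
    rw [show (lam k + (2 * n - 1 - k.val) + 1) / 2 =
      (lam k + 1) / 2 + (2 * n - 1 - k.val) / 2 by omega,
      show (lam k + (2 * n - 1 - k.val)) / 2 = lam k / 2 + (2 * n - 1 - k.val) / 2 by omega]
    ring

theorem map_omegaWeight {T : Type*} [CommRing T] (φ : S →+* T) (a b c d : S) {N : ℕ}
    (lam : Fin N → ℕ) :
    φ (omegaWeight a b c d lam) = omegaWeight (φ a) (φ b) (φ c) (φ d) lam := by
  simp [omegaWeight]

end Weights

/-! ### The bijection between λ and λ + δ -/

section Staircase

theorem add_sub_le_of_strictAnti {N : ℕ} {l : Fin N → ℕ} (hl : StrictAnti l) {i j : Fin N}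
    (h : i ≤ j) : l j + (j.val - i.val) ≤ l i := by
  obtain ⟨k, hk⟩ := Nat.exists_eq_add_of_le (Fin.le_def.mp h)
  induction k generalizing j with
  | zero =>
    have : j = i := Fin.ext (by simpa using hk)
    simp [this]
  | succ k ih =>
    have h1 := j.isLt
    have h2 := ih (j := ⟨i.val + k, by omega⟩) (Fin.le_def.mpr (by simp)) rfl
    have h3 : l j < l ⟨i.val + k, by omega⟩ := hl (Fin.lt_def.mpr (by simp; omega))
    simp only at h2
    omega

/-- N - 1 - j strict descents follow position j, so l j ≥ N - 1 - j and the truncated subtraction is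
exact. -/
theorem sub_staircase_add {N : ℕ} {l : Fin N → ℕ} (hl : StrictAnti l) (j : Fin N) :
    l j - (N - 1 - j) + (N - 1 - j) = l j := by
  have h1 := j.isLt
  have h2 := add_sub_le_of_strictAnti hl (i := j) (j := ⟨N - 1, by omega⟩)
    (Fin.le_def.mpr (by simp; omega))
  simp only at h2
  omega

theorem antitone_sub_staircase {N : ℕ} {l : Fin N → ℕ} (hl : StrictAnti l) :
    Antitone fun j : Fin N => l j - (N - 1 - j) := by
  intro i j h
  have h1 := add_sub_le_of_strictAnti hl h
  have h2 := sub_staircase_add hl i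
  have h3 := sub_staircase_add hl j
  have h4 := Fin.le_def.mp h
  have := j.isLt
  simp only
  omega

theorem strictAnti_add_staircase {N : ℕ} {lam : Fin N → ℕ} (h : Antitone lam) :
    StrictAnti fun j : Fin N => lam j + (N - 1 - j) := by
  intro i j hij
  have h1 := h hij.le
  have h2 := Fin.lt_def.mp hij
  have := j.isLt
  simp only
  omega

end Staircase

/-! ### Power series of order at least k -/

section OrderIdeal

variable {τ : Type*} {R : Type*} [CommRing R]

/-- The power series of order at least `k`. -/
def orderIdeal (τ R : Type*) [CommRing R] (k : ℕ) : Ideal (MvPowerSeries τ R) where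
  carrier := {F | k ≤ F.order}
  add_mem' hF hG := (le_min hF hG).trans MvPowerSeries.min_order_le_add
  zero_mem' := by simp
  smul_mem' F G hG := (le_trans hG le_add_self).trans MvPowerSeries.le_order_mul

theorem mem_orderIdeal {k : ℕ} {F : MvPowerSeries τ R} : F ∈ orderIdeal τ R k ↔ k ≤ F.order :=
  Iff.rfl

theorem eq_zero_of_forall_mem_orderIdeal {F : MvPowerSeries τ R}
    (h : ∀ k, F ∈ orderIdeal τ R k) : F = 0 := by
  ext m
  rw [map_zero]
  refine MvPowerSeries.coeff_of_lt_order (lt_of_lt_of_le ?_ (mem_orderIdeal.mp (h (m.degree + 1))))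
  exact_mod_cast Nat.lt_succ_self _

theorem pow_mem_orderIdeal {F : MvPowerSeries τ R} (h : F.constantCoeff = 0) (k : ℕ) :
    F ^ k ∈ orderIdeal τ R k :=
  MvPowerSeries.le_order_pow_of_constantCoeff_eq_zero k h

theorem subst_mem_orderIdeal {σ : Type*} [Finite σ] {x : σ → MvPowerSeries τ R}
    (hx : ∀ i, (x i).constantCoeff = 0) {k : ℕ} {F : MvPowerSeries σ R}
    (hF : F ∈ orderIdeal σ R k) : F.subst x ∈ orderIdeal τ R k := by
  refine le_trans ?_ (MvPowerSeries.le_order_subst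
    (MvPowerSeries.hasSubst_of_constantCoeff_zero hx) F)
  have h1 : (1 : ℕ∞) ≤ ⨅ i, (x i).order :=
    le_iInf fun i => MvPowerSeries.one_le_order_iff_constCoeff_eq_zero.mpr (hx i)
  calc (k : ℕ∞) ≤ F.order := hF
    _ = 1 * F.order := (one_mul _).symm
    _ ≤ _ := mul_le_mul_left h1 _

theorem isUnit_one_sub {F : MvPowerSeries τ R} (h : F.constantCoeff = 0) : IsUnit (1 - F) := by
  rw [MvPowerSeries.isUnit_iff_constantCoeff]
  simp [h]

end OrderIdeal

/-! ### The series z_n as a top coefficient -/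

section Series

variable {R : Type*} [CommRing R] (a b c d : R)

/-- The sum of `ω(λ) s_λ` over the partitions `λ` such that the entries of `λ + δ` are less than
`L`. -/
noncomputable def truncZ (n L : ℕ) : MvPolynomial (Fin (2 * n)) R :=
  ∑ l ∈ decSeq L (2 * n), MvPolynomial.C (omegaWeight a b c d fun j => l j - (2 * n - 1 - j)) *
    MvPolynomial.map (Int.castRingHom R) (schurPoly fun j => l j - (2 * n - 1 - j))

/-- As s_λ is homogeneous of degree |λ|, a coefficient of degree below k involves only parts below
k, hence entries of λ + δ below k + 2n. -/
theorem z_sub_truncZ_mem (n k : ℕ) :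
    z a b c d n - (truncZ a b c d n (k + 2 * n) : MvPowerSeries (Fin (2 * n)) R) ∈
      orderIdeal (Fin (2 * n)) R k := by
  refine MvPowerSeries.le_order fun m hm => ?_
  have hm : m.degree < k := by exact_mod_cast hm
  rw [map_sub, sub_eq_zero, MvPolynomial.coeff_coe, truncZ, MvPolynomial.coeff_sum]
  simp only [MvPolynomial.coeff_C_mul, MvPolynomial.coeff_map, eq_intCast]
  set e : PartitionLE (2 * n) → Fin (2 * n) → ℕ := fun lam j => lam.1 j + (2 * n - 1 - j) with he
  have hinj : Function.Injective e := fun lam mu h => Subtype.ext <| funext fun j => by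
    simpa [he] using congrFun h j
  set G : (Fin (2 * n) → ℕ) → R := fun l => omegaWeight a b c d (fun j => l j - (2 * n - 1 - j)) *
    ((MvPolynomial.coeff m (schurPoly fun j => l j - (2 * n - 1 - j)) : ℤ) : R) with hG
  have h1 : ∀ lam : PartitionLE (2 * n),
      omegaWeight a b c d lam.1 * Int.cast ((schurPoly lam.1).coeff m) = G (e lam) := by
    intro lam
    simp [hG, he]
  change ∑ᶠ lam : PartitionLE (2 * n),
    omegaWeight a b c d lam.1 * Int.cast ((schurPoly lam.1).coeff m) = ∑ l ∈ _, G l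
  rw [← sum_preimage e (decSeq (k + 2 * n) (2 * n)) hinj.injOn G]
  · simp only [h1]
    refine finsum_eq_sum_of_support_subset _ fun lam hlam => ?_
    rw [coe_preimage, Set.mem_preimage, mem_coe, mem_decSeq]
    refine ⟨fun j => ?_, strictAnti_add_staircase lam.2⟩
    by_contra hlt
    refine hlam ?_
    have h2 : m.degree ≠ ∑ j, lam.1 j := by
      have h3 := single_le_sum (f := lam.1) (fun _ _ => Nat.zero_le _) (mem_univ j)
      simp only [he] at hlt
      omega
    simp only [← h1, coeff_schurPoly_eq_zero lam.1 m h2, Int.cast_zero, mul_zero]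
  · intro l hl hnot
    refine absurd ⟨⟨_, antitone_sub_staircase (mem_decSeq.mp hl).2⟩, ?_⟩ hnot
    exact funext fun j => sub_staircase_add (mem_decSeq.mp hl).2 j

variable {τ : Type*}

theorem eval₂Hom_alternant {S : Type*} [CommRing S] {N : ℕ} (x : Fin N → S) (lam : Fin N → ℕ) :
    MvPolynomial.eval₂Hom (Int.castRingHom _) x (alternant lam) =
      Matrix.det (Matrix.of fun i j => x i ^ (lam j + (N - 1 - j))) := by
  rw [alternant, RingHom.map_det]
  congr 1
  ext i j
  simp

theorem vandermonde_mul_aeval_truncZ (n L : ℕ) (x : Fin (2 * n) → MvPowerSeries τ R) :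
    staircaseWeight (MvPowerSeries.C a) (MvPowerSeries.C b) (MvPowerSeries.C c)
        (MvPowerSeries.C d) n * (MvPolynomial.eval₂Hom (Int.castRingHom _) x (vandermonde (2 * n)) *
      MvPolynomial.aeval x (truncZ a b c d n L)) =
    ∑ l ∈ decSeq L (2 * n), altWeight
      (oddWeight (MvPowerSeries.C a : MvPowerSeries τ R) (MvPowerSeries.C b))
      (evenWeight (MvPowerSeries.C c) (MvPowerSeries.C d)) l *
        Matrix.det (Matrix.of fun i j => x i ^ l j) := by
  rw [truncZ, map_sum, mul_sum, mul_sum]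
  refine sum_congr rfl fun l hl => ?_
  have h := sub_staircase_add (mem_decSeq.mp hl).2
  have h1 := altWeight_add_staircase (MvPowerSeries.C a : MvPowerSeries τ R) (MvPowerSeries.C b)
    (MvPowerSeries.C c) (MvPowerSeries.C d) n fun j => l j - (2 * n - 1 - j)
  have h2 := eval₂Hom_alternant x fun j => l j - (2 * n - 1 - j)
  simp only [h] at h1 h2
  have h3 (p : MvPolynomial (Fin (2 * n)) ℤ) :
      MvPolynomial.aeval x (MvPolynomial.map (Int.castRingHom R) p) =
        MvPolynomial.eval₂Hom (Int.castRingHom _) x p := by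
    rw [MvPolynomial.aeval_def, MvPolynomial.eval₂_map, MvPolynomial.coe_eval₂Hom]
    congr 1
    exact RingHom.ext_int _ _
  rw [h1, ← h2, ← vandermonde_mul_schurPoly, map_mul, map_mul, h3, MvPolynomial.aeval_C,
    ← map_omegaWeight, MvPowerSeries.algebraMap_apply]
  simp only [Algebra.algebraMap_self, RingHom.id_apply]
  ring

/-- The sides agree modulo series of order at least k, for every k: the bound L = k + 2n serves for
truncating both z and the kernel. -/
theorem factorial_mul_subst_z (n : ℕ) {x : Fin (2 * n) → MvPowerSeries τ R}
    (hx : ∀ i, (x i).constantCoeff = 0) :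
    (n.factorial : MvPowerSeries τ R) *
      (staircaseWeight (MvPowerSeries.C a) (MvPowerSeries.C b) (MvPowerSeries.C c)
        (MvPowerSeries.C d) n *
      (MvPolynomial.eval₂Hom (Int.castRingHom _) x (vandermonde (2 * n)) * (z a b c d n).subst x)) =
    topCoeff (2 * n) (matrixForm (fun i j => kernel (MvPowerSeries.C a) (MvPowerSeries.C b)
      (MvPowerSeries.C c) (MvPowerSeries.C d) (x i) (x j)) ^ n) := by
  rw [← sub_eq_zero]
  refine eq_zero_of_forall_mem_orderIdeal fun k => ?_
  have hs := MvPowerSeries.hasSubst_of_constantCoeff_zero hx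
  have h1 := factorial_mul_sum_decSeq_sub_mem (orderIdeal τ R k) (n := n) (L := k + 2 * n)
    (a := MvPowerSeries.C a) (b := MvPowerSeries.C b) (c := MvPowerSeries.C c)
    (d := MvPowerSeries.C d) (x := x) (fun i => isUnit_one_sub (by simp [hx]))
    (fun i j => isUnit_one_sub (by simp [hx]))
    (fun i => by
      rw [pow_add]
      exact Ideal.mul_mem_right _ _ (pow_mem_orderIdeal (hx i) k))
  have h2 := subst_mem_orderIdeal hx (z_sub_truncZ_mem a b c d n k)
  rw [MvPowerSeries.subst_sub hs, MvPowerSeries.subst_coe] at h2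
  rw [← vandermonde_mul_aeval_truncZ] at h1
  have h3 := Ideal.mul_mem_left _ ((n.factorial : MvPowerSeries τ R) *
    (staircaseWeight (MvPowerSeries.C a)
    (MvPowerSeries.C b) (MvPowerSeries.C c) (MvPowerSeries.C d) n *
    MvPolynomial.eval₂Hom (Int.castRingHom _) x (vandermonde (2 * n)))) h2
  convert Ideal.add_mem _ h3 h1 using 1
  ring

end Series

/-! ### The Vandermonde product at (t, -t, x) -/

section Vandermonde

variable {S : Type*} [CommRing S]

theorem eval₂Hom_vandermonde {N : ℕ} (x : Fin N → S) :
    MvPolynomial.eval₂Hom (Int.castRingHom S) x (vandermonde N) =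
      ∏ i, ∏ j, if i < j then x i - x j else 1 := by
  rw [vandermonde, map_prod, prod_filter, Fintype.prod_prod_type]
  simp

theorem eval₂Hom_vandermonde_ne_zero [IsDomain S] {N : ℕ} {x : Fin N → S}
    (hx : Function.Injective x) :
    MvPolynomial.eval₂Hom (Int.castRingHom S) x (vandermonde N) ≠ 0 := by
  rw [eval₂Hom_vandermonde]
  refine prod_ne_zero_iff.mpr fun i _ => prod_ne_zero_iff.mpr fun j _ => ?_
  split_ifs with h
  · exact sub_ne_zero.mpr (hx.ne h.ne)
  · exact one_ne_zero

theorem eval₂Hom_vandermonde_cons_cons_neg {N : ℕ} (t : S) (x : Fin N → S) :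
    MvPolynomial.eval₂Hom (Int.castRingHom S)
        (Fin.cons t (Fin.cons (-t) x) : Fin (N + 1 + 1) → S) (vandermonde (N + 1 + 1)) =
      2 * t * (∏ i, (x i ^ 2 - t ^ 2)) *
        MvPolynomial.eval₂Hom (Int.castRingHom S) x (vandermonde N) := by
  rw [eval₂Hom_vandermonde, eval₂Hom_vandermonde]
  simp only [Fin.prod_univ_succ (n := N + 1), Fin.prod_univ_succ (n := N), Fin.cons_zero,
    Fin.cons_succ, Fin.succ_pos, if_true, if_false, one_mul, Fin.not_lt_zero,
    Fin.succ_lt_succ_iff]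
  have h : ∏ i, (x i ^ 2 - t ^ 2) = (∏ i, (t - x i)) * ∏ i, (-t - x i) := by
    rw [← prod_mul_distrib]
    refine prod_congr rfl fun i _ => ?_
    ring
  rw [h]
  ring

end Vandermonde

/-! ### The identity over a domain of characteristic zero -/

section Domain

variable {R : Type*} [CommRing R]

theorem X_some_sq_sub_X_none_sq_ne_zero [Nontrivial R] {κ : Type*} (i : κ) :
    (MvPowerSeries.X (some i) ^ 2 - MvPowerSeries.X none ^ 2 :
      MvPowerSeries (Option κ) R) ≠ 0 := by
  classical
  intro h
  have h1 := congrArg (MvPowerSeries.coeff (Finsupp.single (some i) 2)) h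
  simp [MvPowerSeries.coeff_X_pow, Finsupp.single_left_inj] at h1

theorem mul_z_subst_pmArgs_of_isDomain [IsDomain R] [CharZero R] {a b c d : R}
    (ha : a ≠ 0) (hb : b ≠ 0) (hc : c ≠ 0) (hd : d ≠ 0) (n : ℕ) :
    ((1 - MvPowerSeries.C (a * b) * MvPowerSeries.X none ^ 2) *
        (1 - MvPowerSeries.C (a * b * c * d) * MvPowerSeries.X none ^ 4) *
        ∏ i : Fin (2 * n), (1 - MvPowerSeries.C (a * b * c * d) *
          MvPowerSeries.X none ^ 2 * MvPowerSeries.X (some i) ^ 2)) *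
      (z a b c d (n + 1)).subst (pmArgs R n) =
      (1 - MvPowerSeries.C (a * c) * MvPowerSeries.X none ^ 2) *
        (z a b c d n).subst (fun i : Fin (2 * n) =>
          (MvPowerSeries.X (some i) : MvPowerSeries (Option (Fin (2 * n))) R)) := by
  set t : MvPowerSeries (Option (Fin (2 * n))) R := MvPowerSeries.X none with ht
  set x : Fin (2 * n) → MvPowerSeries (Option (Fin (2 * n))) R :=
    fun i => MvPowerSeries.X (some i) with hx
  have ht0 : t.constantCoeff = 0 := by simp [ht]
  have hx0 : ∀ i, (x i).constantCoeff = 0 := by simp [hx]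
  have hp : pmArgs R n = (Fin.cons t (Fin.cons (-t) x) : Fin (2 * n + 1 + 1) → _) := rfl
  have hp0 : ∀ i, (pmArgs R n i).constantCoeff = 0 := by
    rw [hp]
    intro s
    change Fin (2 * n + 1 + 1) at s
    refine Fin.cases ?_ (fun s => Fin.cases ?_ (fun s => ?_) s) s <;> simp [ht0, hx0]
  have htne : t ≠ 0 := by
    intro h
    have := congrArg (MvPowerSeries.coeff (Finsupp.single none 1)) h
    simp [ht] at this
  have hC : ∀ r : R, r ≠ 0 → (MvPowerSeries.C r : MvPowerSeries (Option (Fin (2 * n))) R) ≠ 0 :=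
    fun r hr h => hr (by simpa using congrArg MvPowerSeries.constantCoeff h)
  have : IsDomain (MvPowerSeries (Option (Fin (2 * n))) R) := NoZeroDivisors.to_isDomain _
  have : CharZero (MvPowerSeries (Option (Fin (2 * n))) R) :=
    charZero_of_injective_ringHom (f := MvPowerSeries.C)
      ((injective_iff_map_eq_zero _).mpr fun r hr => by_contra fun h => hC r h hr)
  have e1 := factorial_mul_subst_z a b c d (n + 1) hp0
  have e2 := factorial_mul_subst_z a b c d n hx0
  rw [staircaseWeight_succ] at e1
  have hq : (MvPowerSeries.C a * MvPowerSeries.C b * MvPowerSeries.C c * MvPowerSeries.C d :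
      MvPowerSeries (Option (Fin (2 * n))) R) ≠ 0 :=
    mul_ne_zero (mul_ne_zero (mul_ne_zero (hC a ha) (hC b hb)) (hC c hc)) (hC d hd)
  have hw : staircaseWeight (MvPowerSeries.C a : MvPowerSeries (Option (Fin (2 * n))) R)
      (MvPowerSeries.C b) (MvPowerSeries.C c) (MvPowerSeries.C d) n ≠ 0 := by
    refine prod_ne_zero_iff.mpr fun k _ => pow_ne_zero _ ?_
    split_ifs
    · exact mul_ne_zero (hC a ha) (hC b hb)
    · exact mul_ne_zero (hC c hc) (hC d hd)
  simp only [map_mul]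
  generalize (MvPowerSeries.C a : MvPowerSeries (Option (Fin (2 * n))) R) = a' at *
  generalize (MvPowerSeries.C b : MvPowerSeries (Option (Fin (2 * n))) R) = b' at *
  generalize (MvPowerSeries.C c : MvPowerSeries (Option (Fin (2 * n))) R) = c' at *
  generalize (MvPowerSeries.C d : MvPowerSeries (Option (Fin (2 * n))) R) = d' at *
  have hE : ∀ i, IsUnit (1 - a' * b' * c' * d' * t ^ 2 * x i ^ 2) :=
    fun i => isUnit_one_sub (by simp [ht0])
  -- These are the scaling factors u and v of `kernel_four_point`.
  set h : Fin (2 * n) → MvPowerSeries (Option (Fin (2 * n))) R := fun i =>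
    (x i ^ 2 - t ^ 2) * Ring.inverse (1 - a' * b' * c' * d' * t ^ 2 * x i ^ 2) with hh
  have hEh : ∀ i, (1 - a' * b' * c' * d' * t ^ 2 * x i ^ 2) * h i = x i ^ 2 - t ^ 2 := fun i => by
    rw [hh, mul_left_comm, Ring.mul_inverse_cancel _ (hE i), mul_one]
  have hprod : (∏ i, (1 - a' * b' * c' * d' * t ^ 2 * x i ^ 2)) * ∏ i, h i =
      ∏ i, (x i ^ 2 - t ^ 2) := by
    rw [← prod_mul_distrib]
    exact prod_congr rfl fun i _ => hEh i
  have hD : IsUnit (1 - a' * b' * t ^ 2) := isUnit_one_sub (by simp [ht0])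
  have hDt : IsUnit (1 - a' * b' * c' * d' * t ^ 4) := isUnit_one_sub (by simp [ht0])
  have e3 := topCoeff_matrixForm_recursion n
    (fun i j => kernel a' b' c' d' (pmArgs R n i) (pmArgs R n j)) (a' * b' * c' * d') h
    fun i j => kernel_four_point (x := x i) (y := x j) hD
      (isUnit_one_sub (by simp [hx0]))
      (isUnit_one_sub (by simp [hx0])) hDt (hE i) (hE j) (isUnit_one_sub (by simp [hx0]))
      (hEh i) (hEh j)
  have e4 := mul_kernel_neg_sub_kernel hD hDt
  change (kernel a' b' c' d' t (-t) - kernel a' b' c' d' (-t) t) ^ (n + 1) * _ =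
    (kernel a' b' c' d' t (-t) - kernel a' b' c' d' (-t) t) ^ (n + 1) *
      ((n + 1) * (kernel a' b' c' d' t (-t) - kernel a' b' c' d' (-t) t) * _ * _ *
        topCoeff (2 * n) (matrixForm (fun i j => kernel a' b' c' d' (x i) (x j)) ^ n)) at e3
  have h2t : 2 * t ≠ 0 := mul_ne_zero two_ne_zero htne
  have hac : IsUnit (1 - a' * c' * t ^ 2) := isUnit_one_sub (by simp [ht0])
  generalize kernel a' b' c' d' t (-t) - kernel a' b' c' d' (-t) t = p at *
  have hpne : p ≠ 0 := by
    rintro rfl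
    rw [mul_zero] at e4
    exact mul_ne_zero h2t hac.ne_zero e4.symm
  have e5 := mul_left_cancel₀ (pow_ne_zero _ hpne) e3
  have e6 := e1.trans e5
  have hV : MvPolynomial.eval₂Hom (Int.castRingHom _) (pmArgs R n) (vandermonde (2 * (n + 1))) =
      2 * t * (∏ i, (x i ^ 2 - t ^ 2)) *
        MvPolynomial.eval₂Hom (Int.castRingHom _) x (vandermonde (2 * n)) :=
    eval₂Hom_vandermonde_cons_cons_neg t x
  rw [← e2, hV, Nat.factorial_succ, Nat.cast_mul, Nat.cast_add, Nat.cast_one, ← hprod] at e6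
  have hVne : MvPolynomial.eval₂Hom (Int.castRingHom _) x (vandermonde (2 * n)) ≠ 0 :=
    eval₂Hom_vandermonde_ne_zero
      fun i j h => Option.some_injective _ (MvPowerSeries.X_inj.mp h)
  have hhne : ∏ i, h i ≠ 0 := by
    refine right_ne_zero_of_mul (a := ∏ i, (1 - a' * b' * c' * d' * t ^ 2 * x i ^ 2)) ?_
    rw [hprod]
    exact prod_ne_zero_iff.mpr fun i _ => X_some_sq_sub_X_none_sq_ne_zero i
  have hf : ((n + 1) * (n.factorial : MvPowerSeries (Option (Fin (2 * n))) R)) ≠ 0 := by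
    exact mul_ne_zero (Nat.cast_add_one_ne_zero n) (Nat.cast_ne_zero.mpr n.factorial_ne_zero)
  -- Everything common to both Pfaffian expressions is cancelled here; this requires a domain,
  -- characteristic zero and nonzero a, b, c, d.
  refine mul_left_cancel₀ (mul_ne_zero (mul_ne_zero (mul_ne_zero (mul_ne_zero (mul_ne_zero hf
    (pow_ne_zero n hq)) hw) h2t) hhne) hVne) ?_
  generalize ∏ i, h i = H at *
  generalize (MvPolynomial.eval₂Hom (Int.castRingHom _) x (vandermonde (2 * n))) = V at *
  generalize ∏ i, (1 - a' * b' * c' * d' * t ^ 2 * x i ^ 2) = E at *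
  generalize staircaseWeight a' b' c' d' n = w at *
  linear_combination (1 - a' * b' * t ^ 2) * (1 - a' * b' * c' * d' * t ^ 4) * e6 +
    ((n + 1) * n.factorial * (a' * b' * c' * d') ^ n * w * H * V *
      (z a b c d n).subst x) * e4

end Domain

/-! ### Specialization to an arbitrary commutative ring -/

section Specialize

theorem map_z {R T : Type*} [CommRing R] [CommRing T] (φ : R →+* T) (a b c d : R) (n : ℕ) :
    (z a b c d n).map φ = z (φ a) (φ b) (φ c) (φ d) n := by
  ext m
  rw [MvPowerSeries.coeff_map]
  change φ.toAddMonoidHom (∑ᶠ lam : PartitionLE (2 * n), _) = ∑ᶠ lam : PartitionLE (2 * n), _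
  rw [AddMonoidHom.map_finsum _ (finite_support_coeff_z a b c d n m)]
  refine finsum_congr fun lam => ?_
  simp [map_omegaWeight]

/-- With denominators cleared, the identity is the image of the one over ℤ[a, b, c, d] under
evaluation, because `z` and substitution commute with ring maps. -/
theorem mul_z_subst_pmArgs {R : Type*} [CommRing R] (a b c d : R) (n : ℕ) :
    ((1 - MvPowerSeries.C (a * b) * MvPowerSeries.X none ^ 2) *
        (1 - MvPowerSeries.C (a * b * c * d) * MvPowerSeries.X none ^ 4) *
        ∏ i : Fin (2 * n), (1 - MvPowerSeries.C (a * b * c * d) *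
          MvPowerSeries.X none ^ 2 * MvPowerSeries.X (some i) ^ 2)) *
      (z a b c d (n + 1)).subst (pmArgs R n) =
      (1 - MvPowerSeries.C (a * c) * MvPowerSeries.X none ^ 2) *
        (z a b c d n).subst (fun i : Fin (2 * n) =>
          (MvPowerSeries.X (some i) : MvPowerSeries (Option (Fin (2 * n))) R)) := by
  set φ : MvPolynomial (Fin 4) ℤ →+* R :=
    MvPolynomial.eval₂Hom (Int.castRingHom R) ![a, b, c, d] with hφ
  have h := congrArg (MvPowerSeries.map φ) (mul_z_subst_pmArgs_of_isDomain
    (MvPolynomial.X_ne_zero (0 : Fin 4)) (MvPolynomial.X_ne_zero (R := ℤ) (1 : Fin 4))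
    (MvPolynomial.X_ne_zero (2 : Fin 4)) (MvPolynomial.X_ne_zero (3 : Fin 4)) n)
  have hX : ∀ i : Fin (2 * n), (MvPowerSeries.X (some i) :
      MvPowerSeries (Option (Fin (2 * n))) (MvPolynomial (Fin 4) ℤ)).constantCoeff = 0 := by simp
  have hpm : (fun i => MvPowerSeries.map φ (pmArgs (MvPolynomial (Fin 4) ℤ) n i)) =
      pmArgs R n := by
    funext s
    change Fin (2 * n + 1 + 1) at s
    refine Fin.cases ?_ (fun s => Fin.cases ?_ (fun s => ?_) s) s <;> simp [pmArgs]
  simp only [map_mul, MvPowerSeries.map_subst (hasSubst_pmArgs _ n),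
    MvPowerSeries.map_subst (MvPowerSeries.hasSubst_of_constantCoeff_zero hX), map_z, hpm, map_sub,
    map_one, map_prod, map_pow, MvPowerSeries.map_C, MvPowerSeries.map_X] at h
  simpa [hφ] using h

end Specialize

end StanleySchur

theorem mainTheorem5 {R : Type*} [CommRing R] (a b c d : R) (n : ℕ) :
    (StanleySchur.z a b c d (n + 1)).subst (StanleySchur.pmArgs R n) =
      (1 - MvPowerSeries.C (a * c) * MvPowerSeries.X none ^ 2) *
        MvPowerSeries.invOfUnit
          ((1 - MvPowerSeries.C (a * b) * MvPowerSeries.X none ^ 2) *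
            (1 - MvPowerSeries.C (a * b * c * d) * MvPowerSeries.X none ^ 4) *
            ∏ i : Fin (2 * n), (1 - MvPowerSeries.C (a * b * c * d) *
              MvPowerSeries.X none ^ 2 * MvPowerSeries.X (some i) ^ 2)) 1 *
        (StanleySchur.z a b c d n).subst
          (fun i : Fin (2 * n) =>
            (MvPowerSeries.X (some i) : MvPowerSeries (Option (Fin (2 * n))) R)) := by
  -- The denominator has constant coefficient 1, so `invOfUnit` at the unit 1 is its inverse.
  rw [mul_right_comm, ← StanleySchur.mul_z_subst_pmArgs, mul_right_comm,
    MvPowerSeries.mul_invOfUnit _ _ (by simp), one_mul]
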